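/- Let $s$ be a finite signature consisting of unary and binary relation symbols. A structure of signature $s$ is a (possibly empty) set $V$ with a unary or binary relation $\rho_i$ on $V$ for each symbol $i$ of $s$; a structure $\mathcal R$ embeds in $\mathcal S$ if $\mathcal R$ is isomorphic to the substructure of $\mathcal S$ induced on some subset of its domain. A module of a structure with domain $V$ is a set $A\subseteq V$ such that, for every binary relation $\rho_i$, all $a,a'\in A$ and all $x\in V\setminus A$, one has $x\,\rho_i\,a\Leftrightarrow x\,\rho_i\,a'$ and $a\,\rho_i\,x\Leftrightarrow a'\,\rho_i\,x$. A structure is prime if its only modules are $\emptyset$, the singletons and $V$. A class $\mathcal C$ of finite structures of signature $s$ is hereditary if every structure that embeds in a member of $\mathcal C$ belongs to $\mathcal C$. A hereditary class is minimal prime if it contains infinitely many prime structures, while each of its proper hereditary subclasses contains only finitely many; prime structures are counted up to isomorphism. **Theorem.** Every hereditary class of finite structures of signature $s$ that contains infinitely many prime structures contains a minimal prime hereditary subclass. The same holds for hereditary classes of finite graphs (undirected, without loops or multiple edges), with embeddability meaning isomorphism with an induced subgraph, and with modules, prime graphs and minimal prime classes defined in the same way from the adjacency relation. -/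

import Mathlib

open CategoryTheory

universe u v w

/-! ### Binary relational structures

A finite binary signature is a first-order language `L` with no function symbols and finitely many
relation symbols, each of them unary or binary; a structure of signature `L` is an `L`-structure,
and embeddability is existence of an `L`-embedding (an isomorphism onto an induced substructure).
-/

namespace BinaryStructures

/-- `L` is a finite signature all of whose symbols are unary or binary relation symbols. -/
structure IsFiniteBinarySignature (L : FirstOrder.Language.{u, v}) : Prop where
  isRelational : L.IsRelational
  finite_relations : Finite (Σ n, L.Relations n)
  arity : ∀ n, Nonempty (L.Relations n) → n = 1 ∨ n = 2

/-- A module: a set `A` whose elements are not distinguished by any binary relation from outside.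
(Unary relations put no condition on modules.) -/
def IsModule (L : FirstOrder.Language.{u, v}) (V : Type w) [L.Structure V] (A : Set V) : Prop :=
  ∀ r : L.Relations 2, ∀ a ∈ A, ∀ a' ∈ A, ∀ x ∉ A,
    (FirstOrder.Language.Structure.RelMap r ![x, a] ↔ FirstOrder.Language.Structure.RelMap r ![x, a']) ∧
    (FirstOrder.Language.Structure.RelMap r ![a, x] ↔ FirstOrder.Language.Structure.RelMap r ![a', x])

/-- A structure is prime if its only modules are the trivial ones: the empty set, the singletons
and the whole domain. -/
def IsPrime (L : FirstOrder.Language.{u, v}) (V : Type w) [L.Structure V] : Prop :=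
  ∀ A : Set V, IsModule L V A → A = ∅ ∨ (∃ x, A = {x}) ∨ A = Set.univ

/-- A hereditary class of finite structures. `FirstOrder.Language.Hereditary` is closure under passing to
finitely generated embedded structures; as the members are finite and `L` is relational, this means
closure under embeddability. In particular such a class is closed under isomorphism. -/
def IsHereditaryClass {L : FirstOrder.Language.{u, v}} (C : Set (Bundled.{w} L.Structure)) : Prop :=
  (∀ R ∈ C, Finite R) ∧ FirstOrder.Language.Hereditary C

/-- The set of isomorphism types of prime members of `C`. -/
def primeTypes {L : FirstOrder.Language.{u, v}} (C : Set (Bundled.{w} L.Structure)) :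
    Set (Quotient (FirstOrder.Language.equivSetoid (L := L))) :=
  Quotient.mk _ '' {R | R ∈ C ∧ IsPrime L R}

/-- A hereditary class is minimal prime if it contains infinitely many prime structures (up to
isomorphism), while every proper hereditary subclass contains only finitely many. -/
def IsMinimalPrime {L : FirstOrder.Language.{u, v}} (C : Set (Bundled.{w} L.Structure)) : Prop :=
  IsHereditaryClass C ∧ (primeTypes C).Infinite ∧
    ∀ D : Set (Bundled.{w} L.Structure), D ⊂ C → IsHereditaryClass D → (primeTypes D).Finite

end BinaryStructures

/-! ### Graphs

The same notions for undirected graphs without loops; embeddability is isomorphism with an induced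
subgraph. -/

namespace GraphClasses

/-- A module of a graph: a set `A` whose elements have the same neighbours outside of `A`. -/
def IsModule {V : Type w} (G : SimpleGraph V) (A : Set V) : Prop :=
  ∀ a ∈ A, ∀ a' ∈ A, ∀ x ∉ A, (G.Adj x a ↔ G.Adj x a')

/-- A graph is prime if its only modules are the empty set, the singletons and the vertex set. -/
def IsPrime {V : Type w} (G : SimpleGraph V) : Prop :=
  ∀ A : Set V, IsModule G A → A = ∅ ∨ (∃ x, A = {x}) ∨ A = Set.univ

/-- A hereditary class of finite graphs: it contains every graph which embeds in a member. -/
def IsHereditaryClass (C : Set (Bundled.{w} SimpleGraph)) : Prop :=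
  (∀ G ∈ C, Finite G.α) ∧
    ∀ G ∈ C, ∀ H : Bundled.{w} SimpleGraph, Nonempty (H.str ↪g G.str) → H ∈ C

/-- Isomorphism of graphs. -/
def isoSetoid : Setoid (Bundled.{w} SimpleGraph) where
  r G H := Nonempty (G.str ≃g H.str)
  iseqv :=
    { refl := fun _ => ⟨SimpleGraph.Iso.refl⟩
      symm := fun ⟨e⟩ => ⟨e.symm⟩
      trans := fun ⟨e⟩ ⟨f⟩ => ⟨f.comp e⟩ }

/-- The set of isomorphism types of prime members of `C`. -/
def primeTypes (C : Set (Bundled.{w} SimpleGraph)) : Set (Quotient isoSetoid.{w}) :=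
  Quotient.mk _ '' {G | G ∈ C ∧ IsPrime G.str}

/-- A hereditary class of finite graphs is minimal prime if it contains infinitely many prime
graphs (up to isomorphism), while every proper hereditary subclass contains only finitely many. -/
def IsMinimalPrime (C : Set (Bundled.{w} SimpleGraph)) : Prop :=
  IsHereditaryClass C ∧ (primeTypes C).Infinite ∧
    ∀ D : Set (Bundled.{w} SimpleGraph), D ⊂ C → IsHereditaryClass D → (primeTypes D).Finite

end GraphClasses

/-! Apply Zorn's lemma to the hereditary subclasses with infinitely many primes, ordered by reverse
inclusion. The point is that the intersection of a chain still has infinitely many primes, and this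
follows from a gap theorem: a prime structure with at least `n + 3` points has a prime induced
substructure with `n + 3` or `n + 4` points (`IsPrimeOn.exists_ncard_le`). Every class of the chain
thus has a prime in this window of sizes, where only finitely many types exist. If the intersection
had none, each type would be missed by some class, and the smallest of finitely many such classes
would miss them all (`exists_minimal_lowerClass`).

The gap theorem is proved for colourings of ordered pairs, which cover graphs and binary structures
at once. A prime restriction to three or four points starts an induction;
`IsPrimeOn.exists_insert_insert` adds two points at a time. -/

namespace PairColouring

variable {V κ : Type*}

/-- `A ∩ S` is a module of the restriction to `S` of the colouring `c` of ordered pairs. -/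
def IsModuleOn (c : V → V → κ) (S A : Set V) : Prop :=
  ∀ a ∈ A, a ∈ S → ∀ b ∈ A, b ∈ S → ∀ x ∈ S, x ∉ A → c x a = c x b

/-- The restriction of `c` to `S` has only trivial modules. -/
def IsPrimeOn (c : V → V → κ) (S : Set V) : Prop :=
  ∀ A, IsModuleOn c S A → ∀ a ∈ A, a ∈ S → ∀ b ∈ A, b ∈ S → a ≠ b → S ⊆ A

/-- The colour of a pair determines the colour of the reversed pair. -/
def IsReversible (c : V → V → κ) : Prop :=
  ∀ a b a' b', c a b = c a' b' → c b a = c b' a'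

theorem IsModuleOn.mono {c : V → V → κ} {S T A : Set V} (h : IsModuleOn c S A) (hT : T ⊆ S) :
    IsModuleOn c T A :=
  fun a ha haT b hb hbT x hx hxA => h a ha (hT haT) b hb (hT hbT) x (hT hx) hxA

theorem exists_of_not_isPrimeOn {c : V → V → κ} {S : Set V} (h : ¬ IsPrimeOn c S) :
    ∃ A, IsModuleOn c S A ∧ ∃ a ∈ A, a ∈ S ∧ ∃ b ∈ A, b ∈ S ∧ a ≠ b ∧ ∃ s ∈ S, s ∉ A := by
  simp only [IsPrimeOn, not_forall, Set.not_subset] at h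
  obtain ⟨A, hA, a, ha, haS, b, hb, hbS, hab, s, hs, hsA⟩ := h
  exact ⟨A, hA, a, ha, haS, b, hb, hbS, hab, s, hs, hsA⟩

/-! ### Small prime restrictions. -/

section Split

variable {c : V → V → κ}

theorem isPrimeOn_triple {x y z : V} (hx : c x y ≠ c x z) (hy : c y x ≠ c y z)
    (hz : c z x ≠ c z y) : IsPrimeOn c {x, y, z} := by
  intro A hA a ha haS b hb hbS hab s hs
  by_contra hsA
  have h := hA a ha haS b hb hbS s hs hsA
  simp only [Set.mem_insert_iff, Set.mem_singleton_iff] at haS hbS hs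
  grind

/-- The coloured analogue of the path `p - q - r - s`: starting from any two of the points,
repeatedly adding points that distinguish two points already present yields all four. -/
theorem isPrimeOn_path (hc : IsReversible c) {α γ : κ} {p q r s : V} (hpq : c q p = γ)
    (hqr : c q r = γ) (hrs : c s r = γ) (hpr : c p r = α) (hps : c p s = α) (hqs : c q s = α)
    (h1 : γ ≠ α) (h2 : c p q ≠ α) : IsPrimeOn c {p, q, r, s} := by
  have e1 := hc q p q r (hpq.trans hqr.symm)
  have e2 := hc q p s r (hpq.trans hrs.symm)
  have e3 := hc p r p s (hpr.trans hps.symm)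
  have e4 := hc p r q s (hpr.trans hqs.symm)
  have h3 : c r p ≠ c q p := fun h => h2 ((hc _ _ _ _ h).symm.trans hpr)
  have h4 : c r p ≠ c p q := fun h => h1 (hpq.symm.trans ((hc _ _ _ _ h).symm.trans hpr))
  intro A hA a ha haS b hb hbS hab
  have hM : ∀ u ∈ ({p, q, r, s} : Set V), ∀ v ∈ ({p, q, r, s} : Set V),
      ∀ t ∈ ({p, q, r, s} : Set V), c t u ≠ c t v → u ∈ A → v ∈ A → t ∈ A := by
    intro u hu v hv t ht hne huA hvA
    by_contra htA
    exact hne (hA u huA hu v hvA hv t ht htA)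
  simp only [Set.mem_insert_iff, Set.mem_singleton_iff, forall_eq_or_imp, forall_eq] at haS hbS hM
  intro t ht
  simp only [Set.mem_insert_iff, Set.mem_singleton_iff] at ht
  grind

/-- `W` is the union of two nonempty disjoint sets, all pairs from the first to the second having
the same colour. -/
def HasSplit (c : V → V → κ) (W : Set V) : Prop :=
  ∃ A B : Set V, ∃ α, A.Nonempty ∧ B.Nonempty ∧ Disjoint A B ∧ A ∪ B = W ∧
    ∀ a ∈ A, ∀ b ∈ B, c a b = α

/-- Without prime triples, among any three points one sees the other two in the same colour. This
limits the colours between `x` and the old parts so much that either `x` joins a part, or `x` is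
split off alone, or one part is cut in two according to its colours with `x`. Only a four-point path
can obstruct such a cut. -/
theorem hasSplit_insert (hc : IsReversible c) {W : Set V} {x : V} (hx : x ∉ W)
    (hW : HasSplit c W)
    (h3 : ∀ S ⊆ insert x W, S.ncard = 3 → ¬ IsPrimeOn c S)
    (h4 : ∀ S ⊆ insert x W, S.ncard = 4 → ¬ IsPrimeOn c S) : HasSplit c (insert x W) := by
  obtain ⟨A, B, α, ⟨a₀, ha₀⟩, ⟨b₀, hb₀⟩, hd, rfl, hAB⟩ := hW
  have hd' : ∀ a ∈ A, a ∉ B := fun a ha hb => Set.disjoint_left.1 hd ha hb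
  have triple : ∀ u v w : V, u ∈ insert x (A ∪ B) → v ∈ insert x (A ∪ B) → w ∈ insert x (A ∪ B) →
      u ≠ v → u ≠ w → v ≠ w → c u v ≠ c u w → c v u ≠ c v w → c w u = c w v := by
    intro u v w hu hv hw huv huw hvw h1 h2
    by_contra h
    refine h3 {u, v, w} ?_ (by rw [Set.ncard_eq_three]; exact ⟨u, v, w, huv, huw, hvw, rfl⟩)
      (isPrimeOn_triple h1 h2 h)
    simp only [Set.insert_subset_iff, Set.singleton_subset_iff]
    exact ⟨hu, hv, hw⟩
  have path : ∀ γ β : κ, ∀ p q r s : V, p ∈ insert x (A ∪ B) → q ∈ insert x (A ∪ B) →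
      r ∈ insert x (A ∪ B) → s ∈ insert x (A ∪ B) → p ≠ q → p ≠ r → p ≠ s → q ≠ r → q ≠ s →
      r ≠ s → c q p = γ → c q r = γ → c s r = γ → c p r = β → c p s = β → c q s = β →
      γ ≠ β → c p q ≠ β → False := by
    intro γ β p q r s hp hq hr hs h12 h13 h14 h23 h24 h34 e1 e2 e3 e4 e5 e6 e7 e8
    refine h4 {p, q, r, s} ?_ ?_ (isPrimeOn_path hc e1 e2 e3 e4 e5 e6 e7 e8)
    · simp only [Set.insert_subset_iff, Set.singleton_subset_iff]
      exact ⟨hp, hq, hr, hs⟩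
    · rw [Set.ncard_insert_of_notMem (by simp [*]), Set.ncard_eq_three.2 ⟨q, r, s, h23, h24, h34, rfl⟩]
  by_cases hxB : ∀ b ∈ B, c x b = α
  · exact ⟨insert x A, B, α, ⟨x, by simp⟩, ⟨b₀, hb₀⟩, by
      rw [Set.disjoint_left]; grind, by rw [Set.insert_union], by grind⟩
  push Not at hxB
  obtain ⟨w, hw, hxw⟩ := hxB
  -- In the triple `y`, `w`, `x`, both `y` and `w` distinguish the other two, so `x` cannot.
  have hAγ : ∀ y ∈ A, c y x ≠ α → c x y = c x w := by
    intro y hy hyx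
    have h := triple y w x (by grind) (by grind) (by grind) (by grind) (by grind) (by grind)
    grind [IsReversible]
  by_cases hA1 : ∃ z ∈ A, c z x = α
  · by_cases hA2 : ∀ z ∈ A, c z x = α → ∀ y ∈ A, c y x ≠ α → c z y = α
    · refine ⟨{z ∈ A | c z x = α}, insert x ({y ∈ A | c y x ≠ α} ∪ B), α, hA1, ⟨x, by simp⟩,
        ?_, ?_, ?_⟩
      · rw [Set.disjoint_left]; grind
      · ext t; grind
      · grind
    · exfalso
      push Not at hA2
      obtain ⟨z, hz, hzx, y, hy, hyx, hzy⟩ := hA2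
      have hzy' : c z y = c x y := by
        by_contra hne
        have h := triple z y x (by grind) (by grind) (by grind) (by grind) (by grind) (by grind)
        grind [IsReversible]
      have e0 := hAγ y hy hyx
      have e1 := hc y w z w (by grind)
      have e2 := hc y w z x (by grind)
      have e3 := hc x y x w e0
      exact path (c x w) (c w y) w x y z (by grind) (by grind) (by grind) (by grind) (by grind)
        (by grind) (by grind) (by grind) (by grind) (by grind) rfl (by grind) (by grind) rfl
        (by grind) (by grind) (fun h => by have := hc x w w y h; grind)
        (fun h => by have := hc w x w y h; grind)
  push Not at hA1
  by_cases hB : ∀ w' ∈ B, c x w' = c x w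
  · refine ⟨{x}, A ∪ B, c x w, ⟨x, rfl⟩, ⟨w, Or.inr hw⟩, ?_, rfl, ?_⟩
    · rw [Set.disjoint_left]; grind
    · grind
  push Not at hB
  have hBα : ∀ z ∈ B, c x z ≠ c x w → c x z = α := by
    intro z hz hzx
    have h := triple a₀ z x (by grind) (by grind) (by grind) (by grind) (by grind) (by grind)
    grind [IsReversible]
  by_cases hB2 : ∀ z ∈ B, c x z ≠ c x w → ∀ y ∈ B, c x y = c x w → c y z = α
  · refine ⟨insert x (A ∪ {y ∈ B | c x y = c x w}), {z ∈ B | c x z ≠ c x w}, α, ⟨x, by simp⟩,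
      hB, ?_, ?_, ?_⟩
    · rw [Set.disjoint_left]; grind
    · ext t; grind
    · grind
  · exfalso
    push Not at hB2
    obtain ⟨z, hz, hzx, y, hy, hyx, hyz⟩ := hB2
    have hxz := hBα z hz hzx
    have hyz' : c z y = c x y := by
      by_contra hne
      have h := triple x z y (by grind) (by grind) (by grind) (by grind) (by grind) (by grind)
      grind [IsReversible]
    exact path (c x w) α a₀ x y z (by grind) (by grind) (by grind) (by grind) (by grind) (by grind)
      (by grind) (by grind) (by grind) (by grind) (by grind) (by grind) (by grind) (by grind)
      (by grind) (by grind) (by grind) (by grind)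

theorem hasSplit_of_forall_not_isPrimeOn [Finite V] (hc : IsReversible c) (W : Set V)
    (hW : 2 ≤ W.ncard) (h3 : ∀ S ⊆ W, S.ncard = 3 → ¬ IsPrimeOn c S)
    (h4 : ∀ S ⊆ W, S.ncard = 4 → ¬ IsPrimeOn c S) : HasSplit c W := by
  induction W, W.toFinite using Set.Finite.induction_on with
  | empty => simp at hW
  | @insert x W hx _ ih =>
    rw [Set.ncard_insert_of_notMem hx] at hW
    rcases (by omega : W.ncard = 1 ∨ 2 ≤ W.ncard) with h1 | h2
    · obtain ⟨y, rfl⟩ := Set.ncard_eq_one.1 h1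
      exact ⟨{x}, {y}, c x y, by simp, by simp, by simpa using hx, rfl, by simp⟩
    · exact hasSplit_insert hc hx (ih h2 (fun S hS => h3 S (hS.trans (Set.subset_insert _ _)))
        (fun S hS => h4 S (hS.trans (Set.subset_insert _ _)))) h3 h4

/-- A prime colouring on at least three points has a prime restriction to three or four points. -/
theorem IsPrimeOn.exists_ncard_eq_three_or_four [Finite V] (hc : IsReversible c) {W : Set V}
    (hW : 3 ≤ W.ncard) (hp : IsPrimeOn c W) :
    ∃ S ⊆ W, (S.ncard = 3 ∨ S.ncard = 4) ∧ IsPrimeOn c S := by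
  by_contra! h
  obtain ⟨A, B, α, ⟨a, ha⟩, ⟨b, hb⟩, hd, rfl, hAB⟩ := hasSplit_of_forall_not_isPrimeOn hc W
    (by omega) (fun S hS h3 => h S hS (Or.inl h3)) (fun S hS h4 => h S hS (Or.inr h4))
  have hd' : ∀ a ∈ A, a ∉ B := fun a ha hb => Set.disjoint_left.1 hd ha hb
  rw [Set.ncard_union_eq hd] at hW
  -- Either side of a split is a module, and one of them has two points.
  rcases (by omega : 1 < A.ncard ∨ 1 < B.ncard) with h1 | h1
  · obtain ⟨x, y, hx, hy, hxy⟩ := (Set.one_lt_ncard_iff).1 h1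
    have := hp A (fun _ _ _ _ _ _ _ _ _ => hc _ _ _ _ (by grind)) x hx (Or.inl hx) y hy
      (Or.inl hy) hxy (Or.inr hb)
    exact hd' b this hb
  · obtain ⟨x, y, hx, hy, hxy⟩ := (Set.one_lt_ncard_iff).1 h1
    have := hp B (fun _ _ _ _ _ _ _ _ _ => by grind) x hx (Or.inr hx) y hy
      (Or.inr hy) hxy (Or.inl ha)
    exact hd' a ha this

end Split

/-! ### Adding points to a prime restriction. -/

section Extension

variable {c : V → V → κ} {X : Set V}

/-- The point `u` does not distinguish the elements of `X`. -/
def IsUniformOn (c : V → V → κ) (X : Set V) (u : V) : Prop :=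
  ∀ a ∈ X, ∀ b ∈ X, c u a = c u b

/-- No element of `X` other than `v` distinguishes `u` from `v`. -/
def AreTwinsOn (c : V → V → κ) (X : Set V) (v u : V) : Prop :=
  ∀ z ∈ X, z ≠ v → c z u = c z v

/-- A nontrivial module of `insert u X` meets `X` in a module of `X`: either all of `X`, which
leaves `u` outside, or one point `v`, which puts `u` with `v`. -/
theorem isPrimeOn_or_isUniformOn_or_areTwinsOn (hX : IsPrimeOn c X) (u : V) :
    IsPrimeOn c (insert u X) ∨ IsUniformOn c X u ∨ ∃ v ∈ X, AreTwinsOn c X v u := by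
  by_contra! h
  obtain ⟨h1, h2, h3⟩ := h
  obtain ⟨M, hM, a, ha, haS, b, hb, hbS, hab, s, hs, hsM⟩ := exists_of_not_isPrimeOn h1
  have hMX := hX M (hM.mono (Set.subset_insert _ _))
  by_cases hv : X ⊆ M
  · refine h2 fun p hp q hq => ?_
    have := hM p (hv hp) (Or.inr hp) q (hv hq) (Or.inr hq) s hs hsM
    grind
  · have key : ∃ v ∈ X, v ∈ M ∧ u ∈ M := by grind
    obtain ⟨v, hv1, hv2, hv3⟩ := key
    refine h3 v hv1 fun z hz hzv => hM u hv3 (by grind) v hv2 (by grind) z (by grind) ?_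
    exact fun hzM => hv (hMX z hzM hz v hv2 hv1 hzv)

/-- Otherwise `v`, like its twin `u`, would see all of `X \ {v}` in one colour, making this set a
nontrivial module of `X`. -/
theorem not_isUniformOn_of_areTwinsOn (hc : IsReversible c) (hX : IsPrimeOn c X)
    (h3 : 2 < X.ncard) {u v : V} (hv : v ∈ X) (h : AreTwinsOn c X v u) : ¬ IsUniformOn c X u := by
  intro hu
  obtain ⟨a, ha, hav⟩ := Set.exists_ne_of_one_lt_ncard (by omega : 1 < X.ncard) v
  obtain ⟨b, hb, hbv, hba⟩ : ∃ b ∈ X, b ≠ v ∧ b ≠ a := by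
    by_contra! hcon
    have : X.ncard ≤ ({v, a} : Set V).ncard := Set.ncard_le_ncard (by
      intro z hz; by_cases z = v <;> grind) (by simp)
    rw [Set.ncard_pair hav.symm] at this
    omega
  refine absurd (hX {v}ᶜ ?_ a hav ha b hbv hb hba.symm hv) (by simp)
  intro p hp hpX q hq hqX x hx hxv
  obtain rfl : x = v := by simpa using hxv
  have e1 := hc _ _ _ _ (h p hpX hp)
  have e2 := hc _ _ _ _ (h q hqX hq)
  rw [← e1, ← e2]
  exact hu p hpX q hqX

theorem AreTwinsOn.eq (hX : IsPrimeOn c X) (h3 : 2 < X.ncard) {u v w : V} (hv : v ∈ X)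
    (hw : w ∈ X) (h : AreTwinsOn c X v u) (h' : AreTwinsOn c X w u) : v = w := by
  by_contra hne
  have hsub := hX {v, w} ?_ v (by simp) hv w (by simp) hw hne
  · have := Set.ncard_le_ncard hsub
    rw [Set.ncard_pair hne] at this
    omega
  · intro p hp _ q hq _ z hz hzA
    have e1 := h z hz (by grind)
    have e2 := h' z hz (by grind)
    grind

/-- A nontrivial module of the extended set contains `X` or meets it in at most one point. In the
surviving cases it contains `y` and a point of `X` but not `x`; were it disjoint from `X`, it would
contain both `x` and `y` and force `y` to be uniform. -/
theorem eq_of_isUniformOn_of_not_isUniformOn (hc : IsReversible c) (hX : IsPrimeOn c X)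
    (h3 : 2 < X.ncard) {x y : V}
    (hn : ¬ IsPrimeOn c (insert x (insert y X)))
    (hxu : IsUniformOn c X x) (hyu : ¬ IsUniformOn c X y) :
    ∀ v ∈ X, c x y = c x v := by
  have hxt := fun v hv h => not_isUniformOn_of_areTwinsOn hc hX h3 (u := x) (v := v) hv h hxu
  obtain ⟨M, hM, a, ha, haS, b, hb, hbS, hab, s, hs, hsM⟩ := exists_of_not_isPrimeOn hn
  have hMX := hX M (hM.mono (by grind))
  by_cases hXM : X ⊆ M
  · have hyM : y ∈ M := by
      by_contra hyM
      exact hyu fun p hp q hq => hM p (hXM hp) (by grind) q (hXM hq) (by grind) y (by grind) hyM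
    intro v hv
    exact hM y hyM (by grind) v (hXM hv) (by grind) x (by grind) (by grind)
  · have hM1 : ∀ v ∈ X, v ∈ M → x ∉ M := by
      intro v hv hvM hxM
      refine hxt v hv fun z hz hzv => hM x hxM (by grind) v hvM (by grind) z (by grind) ?_
      exact fun hzM => hXM (hMX z hzM hz v hvM hv hzv)
    by_cases hM2 : ∃ v ∈ X, v ∈ M
    · obtain ⟨v, hv, hvM⟩ := hM2
      have hyM : y ∈ M := by grind
      have := hM y hyM (by grind) v hvM (by grind) x (by grind) (hM1 v hv hvM)
      intro w hw
      exact this.trans (hxu v hv w hw)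
    · exfalso
      refine hyu fun p hp q hq => ?_
      have e1 := hc _ _ _ _ (hM x (by grind) (by grind) y (by grind) (by grind) p (by grind)
        (by grind))
      have e2 := hc _ _ _ _ (hM x (by grind) (by grind) y (by grind) (by grind) q (by grind)
        (by grind))
      rw [← e1, ← e2]
      exact hxu p hp q hq

theorem eq_of_areTwinsOn_of_not_areTwinsOn (hc : IsReversible c) (hX : IsPrimeOn c X)
    (h3 : 2 < X.ncard) {x y : V}
    (hn : ¬ IsPrimeOn c (insert x (insert y X))) {u : V} (hu : u ∈ X)
    (hxu : AreTwinsOn c X u x) (hyu : ¬ AreTwinsOn c X u y) : c y x = c y u := by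
  have hxt := not_isUniformOn_of_areTwinsOn hc hX h3 hu hxu
  obtain ⟨M, hM, a, ha, haS, b, hb, hbS, hab, s, hs, hsM⟩ := exists_of_not_isPrimeOn hn
  have hMX := hX M (hM.mono (by grind))
  by_cases hXM : X ⊆ M
  · have hxM : x ∈ M := by
      by_contra hxM
      exact hxt fun p hp q hq => hM p (hXM hp) (by grind) q (hXM hq) (by grind) x (by grind) hxM
    exact hM x hxM (by grind) u (hXM hu) (by grind) y (by grind) (by grind)
  · have hM1 : ∀ v ∈ X, v ∈ M → ∀ t ∈ M, t = x ∨ t = y → AreTwinsOn c X v t := by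
      intro v hv hvM t htM ht z hz hzv
      refine hM t htM (by grind) v hvM (by grind) z (by grind) ?_
      exact fun hzM => hXM (hMX z hzM hz v hvM hv hzv)
    by_cases hM2 : ∃ v ∈ X, v ∈ M
    · obtain ⟨v, hv, hvM⟩ := hM2
      by_cases hxM : x ∈ M
      · obtain rfl := hxu.eq hX h3 hu hv (hM1 v hv hvM x hxM (Or.inl rfl))
        have hyM : y ∉ M := fun hyM => hyu (hM1 u hu hvM y hyM (Or.inr rfl))
        exact hM x hxM (by grind) u hvM (by grind) y (by grind) hyM
      · have hyM : y ∈ M := by grind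
        have hty := hM1 v hv hvM y hyM (Or.inr rfl)
        have hvu : v ≠ u := by rintro rfl; exact hyu hty
        have e1 := hM y hyM (by grind) v hvM (by grind) x (by grind) hxM
        have e2 := hc _ _ _ _ (hxu v hv hvu)
        have e3 := hty u hu hvu.symm
        exact hc _ _ _ _ (e1.trans (e2.trans e3.symm))
    · exfalso
      refine hyu fun z hz hzu => ?_
      have := hM x (by grind) (by grind) y (by grind) (by grind) z (by grind) (by grind)
      rw [← this]
      exact hxu z hz hzu

/-- Primality of both one-point extensions leaves only `{x, y}` as the trace of a nontrivial module.
-/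
theorem eq_of_isPrimeOn_insert (h3 : 2 < X.ncard) {x y : V} (hx : x ∉ X) (hy : y ∉ X)
    (hn : ¬ IsPrimeOn c (insert x (insert y X)))
    (hxp : IsPrimeOn c (insert x X)) (hyp : IsPrimeOn c (insert y X)) : ∀ z ∈ X, c z x = c z y := by
  obtain ⟨M, hM, a, ha, haS, b, hb, hbS, hab, s, hs, hsM⟩ := exists_of_not_isPrimeOn hn
  obtain ⟨p, q, hp, hq, hpq⟩ := (Set.one_lt_ncard_iff (Set.finite_of_ncard_ne_zero (by omega))).1
    (by omega : 1 < X.ncard)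
  have h1 := hxp M (hM.mono (by grind))
  have h2 := hyp M (hM.mono (by grind))
  have hXM : ∀ z ∈ X, z ∉ M := by
    intro z hz hzM
    by_cases hxM : x ∈ M
    · have h1' := h1 z hzM (by grind) x hxM (by grind) (by grind)
      have h2' := h2 p (h1' (by grind)) (by grind) q (h1' (by grind)) (by grind) hpq
      grind
    · by_cases hyM : y ∈ M
      · have h2' := h2 z hzM (by grind) y hyM (by grind) (by grind)
        have h1' := h1 p (h2' (by grind)) (by grind) q (h2' (by grind)) (by grind) hpq
        grind
      · have h1' := h1 a ha (by grind) b hb (by grind) hab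
        grind
  exact fun z hz => hM x (by grind) (by grind) y (by grind) (by grind) z (by grind) (hXM z hz)

/-- **Ehrenfeucht–Rozenberg**: a prime restriction missing at least two points of a prime
restriction stays prime after adding two suitable points. -/
theorem IsPrimeOn.exists_insert_insert (hc : IsReversible c) {W : Set V} (hW : IsPrimeOn c W)
    (hXW : X ⊆ W) (hX : IsPrimeOn c X) (h3 : 2 < X.ncard) (hd : 1 < (W \ X).ncard) :
    ∃ x ∈ W \ X, ∃ y ∈ W \ X, x ≠ y ∧ IsPrimeOn c (insert x (insert y X)) := by
  by_contra! hn
  obtain ⟨p, q, hp, hq, hpq⟩ := (Set.one_lt_ncard_iff (Set.finite_of_ncard_ne_zero (by omega))).1 hd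
  obtain ⟨g, h, hg, hh, hgh⟩ := (Set.one_lt_ncard_iff (Set.finite_of_ncard_ne_zero (by omega))).1
    (by omega : 1 < X.ncard)
  -- If no pair of points works, the types of outside points yield modules of `W`. Here `u` together
  -- with its outside twins is one.
  have htw : ∀ u ∈ X, ∀ x ∈ W \ X, ¬ AreTwinsOn c X u x := by
    intro u hu x hx hxu
    obtain ⟨k, hk, hku⟩ := Set.exists_ne_of_one_lt_ncard (by omega : 1 < X.ncard) u
    have key : ∀ z ∈ W, z ∉ insert u {t | t ∉ X ∧ AreTwinsOn c X u t} →
        ∀ t ∈ insert u {t | t ∉ X ∧ AreTwinsOn c X u t}, t ∈ W → c z t = c z u := by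
      intro z hz hzM t ht htW
      rcases ht with rfl | ⟨htX, ht⟩
      · rfl
      by_cases hzX : z ∈ X
      · exact ht z hzX (by grind)
      · exact eq_of_areTwinsOn_of_not_areTwinsOn hc hX h3
          (hn t ⟨htW, htX⟩ z ⟨hz, hzX⟩ (by grind)) hu ht (by grind)
    have := hW (insert u {t | t ∉ X ∧ AreTwinsOn c X u t})
      (fun a ha haW b hb hbW z hz hzM => (key z hz hzM a ha haW).trans (key z hz hzM b hb hbW).symm)
      u (by simp) (hXW hu) x (by grind) hx.1 (by grind) (hXW hk)
    grind
  -- Here the module consists of `X` and the outside points that are not uniform; it misses `x`.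
  have hun : ∀ x ∈ W \ X, ¬ IsUniformOn c X x := by
    intro x hx hxu
    have key : ∀ z ∈ W, z ∉ {t | t ∈ X ∨ ¬ IsUniformOn c X t} →
        ∀ t ∈ {t | t ∈ X ∨ ¬ IsUniformOn c X t}, t ∈ W → c z t = c z g := by
      intro z hz hzM t ht htW
      simp only [Set.mem_ofPred_eq, not_or, not_not] at ht hzM
      by_cases htX : t ∈ X
      · exact hzM.2 t htX g hg
      · exact eq_of_isUniformOn_of_not_isUniformOn hc hX h3
          (hn z ⟨hz, hzM.1⟩ t ⟨htW, htX⟩ (by grind)) hzM.2 (by grind) g hg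
    have := hW {t | t ∈ X ∨ ¬ IsUniformOn c X t}
      (fun a ha haW b hb hbW z hz hzM => (key z hz hzM a ha haW).trans (key z hz hzM b hb hbW).symm)
      g (Or.inl hg) (hXW hg) h (Or.inl hh) (hXW hh) hgh hx.1
    grind
  have hpr : ∀ x ∈ W \ X, IsPrimeOn c (insert x X) := by
    intro x hx
    rcases isPrimeOn_or_isUniformOn_or_areTwinsOn hX x with h | h | ⟨v, hv, h⟩
    · exact h
    · exact absurd h (hun x hx)
    · exact absurd h (htw v hv x hx)
  -- Now every one-point extension is prime, so no point of `X` distinguishes two points of `W \ X`.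
  have := hW Xᶜ ?_ p hp.2 hp.1 q hq.2 hq.1 hpq (hXW hg)
  · exact this hg
  · intro a ha haW b hb hbW z hz hzX
    by_cases hab : a = b
    · rw [hab]
    · exact eq_of_isPrimeOn_insert h3 ha hb (hn a ⟨haW, ha⟩ b ⟨hbW, hb⟩ hab)
        (hpr a ⟨haW, ha⟩) (hpr b ⟨hbW, hb⟩) z (by simpa using hzX)

end Extension

/-- A large prime colouring has prime restrictions of every size up to an error of one. -/
theorem IsPrimeOn.exists_ncard_le [Finite V] {c : V → V → κ} (hc : IsReversible c) {W : Set V}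
    (hW : IsPrimeOn c W) {n : ℕ} (hn : n + 3 ≤ W.ncard) :
    ∃ S ⊆ W, n + 3 ≤ S.ncard ∧ S.ncard ≤ n + 4 ∧ IsPrimeOn c S := by
  induction n with
  | zero =>
    obtain ⟨S, hS, h, hp⟩ := hW.exists_ncard_eq_three_or_four hc hn
    exact ⟨S, hS, by omega, by omega, hp⟩
  | succ n ih =>
    obtain ⟨S, hS, h1, h2, hp⟩ := ih (by omega)
    by_cases h4 : n + 4 ≤ S.ncard
    · exact ⟨S, hS, by omega, by omega, hp⟩
    by_cases h5 : W.ncard ≤ n + 5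
    · exact ⟨W, subset_rfl, by omega, by omega, hW⟩
    -- Here `S` has exactly `n + 3` points, and two more give `n + 5`, the upper end of the next
    -- window.
    have hd := Set.ncard_sdiff_add_ncard_of_subset hS
    obtain ⟨x, hx, y, hy, hxy, hp'⟩ := hW.exists_insert_insert hc hS hp (by omega) (by omega)
    refine ⟨_, ?_, ?_, ?_, hp'⟩
    · grind
    all_goals
      rw [Set.ncard_insert_of_notMem (by grind), Set.ncard_insert_of_notMem hy.2]
      omega

end PairColouring

/-! ### Minimal classes by Zorn's lemma. -/

section MinimalClass

variable {α : Type*} {s : Setoid α} {r : α → α → Prop} {size : α → ℕ} {P : α → Prop} {C : Set α}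

/-- If every large member of `C` satisfying `P` has smaller ones of controlled size below it, then
a downward closed class with infinitely many types satisfying `P` contains a minimal one. -/
theorem exists_minimal_lowerClass (hiso : ∀ R S, s.r R S → r R S)
    (hsize : ∀ R S, s.r R S → size R = size S)
    (hfin : ∀ n, (Quotient.mk s '' {R | R ∈ C ∧ size R ≤ n}).Finite)
    (hstep : ∀ n, ∀ R ∈ C, P R → n + 3 ≤ size R →
      ∃ S, r S R ∧ n + 3 ≤ size S ∧ size S ≤ n + 4 ∧ P S)
    (hC : ∀ R ∈ C, ∀ S, r S R → S ∈ C)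
    (hinf : (Quotient.mk s '' {R | R ∈ C ∧ P R}).Infinite) :
    ∃ D ⊆ C, (∀ R ∈ D, ∀ S, r S R → S ∈ D) ∧ (Quotient.mk s '' {R | R ∈ D ∧ P R}).Infinite ∧
      ∀ E ⊂ D, (∀ R ∈ E, ∀ S, r S R → S ∈ E) → (Quotient.mk s '' {R | R ∈ E ∧ P R}).Finite := by
  -- Otherwise, by `hstep`, members satisfying `P` would have bounded size, hence finitely many
  -- types.
  have large : ∀ D ⊆ C, (∀ R ∈ D, ∀ S, r S R → S ∈ D) →
      (Quotient.mk s '' {R | R ∈ D ∧ P R}).Infinite →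
      ∀ n, ∃ R ∈ D, P R ∧ n + 3 ≤ size R ∧ size R ≤ n + 4 := by
    intro D hDC hD hDinf n
    by_contra! hcon
    refine hDinf ((hfin (n + 3)).subset (Set.image_mono ?_))
    rintro R ⟨hR, hPR⟩
    refine ⟨hDC hR, ?_⟩
    by_contra! hlt
    obtain ⟨S, hSR, h1, h2, hPS⟩ := hstep n R (hDC hR) hPR hlt.le
    exact absurd h2 (not_le.2 (hcon S (hD R hR S hSR) hPS h1))
  have infinite_of_large : ∀ D : Set α, (∀ n, ∃ R ∈ D, P R ∧ n ≤ size R) →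
      (Quotient.mk s '' {R | R ∈ D ∧ P R}).Infinite := by
    intro D hD hfinD
    obtain ⟨N, hN⟩ := (hfinD.image (Quotient.lift size hsize)).bddAbove
    obtain ⟨R, hR, hPR, hlt⟩ := hD (N + 1)
    have := hN ⟨_, ⟨R, ⟨hR, hPR⟩, rfl⟩, rfl⟩
    simp only [Quotient.lift_mk] at this
    omega
  let 𝒮 : Set (Set α) := {D | D ⊆ C ∧ (∀ R ∈ D, ∀ S, r S R → S ∈ D) ∧
    (Quotient.mk s '' {R | R ∈ D ∧ P R}).Infinite}
  suffices hchain : ∀ 𝒟 ⊆ 𝒮, IsChain (· ⊆ ·) 𝒟 → 𝒟.Nonempty → ∃ B ∈ 𝒮, ∀ D ∈ 𝒟, B ⊆ D by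
    obtain ⟨D, hDC, hD⟩ := zorn_superset_nonempty 𝒮 hchain C ⟨subset_rfl, hC, hinf⟩
    refine ⟨D, hDC, hD.prop.2.1, hD.prop.2.2, fun E hE hEr => ?_⟩
    by_contra hEinf
    exact hE.2 (hD.le_of_le ⟨hE.1.trans hDC, hEr, hEinf⟩ hE.1)
  intro 𝒟 h𝒟 hchain ⟨D₀, hD₀⟩
  refine ⟨⋂₀ 𝒟, ⟨(Set.sInter_subset_of_mem hD₀).trans (h𝒟 hD₀).1,
    fun R hR S hSR D hD => (h𝒟 hD).2.1 R (hR D hD) S hSR, ?_⟩,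
    fun D hD => Set.sInter_subset_of_mem hD⟩
  refine infinite_of_large _ fun n => ?_
  by_contra! hcon
  -- In a chain, finitely many types that are each missed by some class are all missed by a single
  -- class.
  have key : ∀ T : Set (Quotient s), T.Finite → (∀ q ∈ T, ∃ D ∈ 𝒟, q ∉ Quotient.mk s '' D) →
      ∃ D ∈ 𝒟, ∀ q ∈ T, q ∉ Quotient.mk s '' D := by
    intro T hT
    induction T, hT using Set.Finite.induction_on with
    | empty => exact fun _ => ⟨D₀, hD₀, by simp⟩
    | @insert q T _ _ ih =>
      intro h
      obtain ⟨D₁, hD₁, h₁⟩ := ih fun q hq => h q (Or.inr hq)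
      obtain ⟨D₂, hD₂, h₂⟩ := h q (Or.inl rfl)
      rcases hchain.total hD₁ hD₂ with hle | hle
      · exact ⟨D₁, hD₁, by
          rintro q' (rfl | hq')
          · exact fun h => h₂ (Set.image_mono hle h)
          · exact h₁ q' hq'⟩
      · exact ⟨D₂, hD₂, by
          rintro q' (rfl | hq')
          · exact h₂
          · exact fun h => h₁ q' hq' (Set.image_mono hle h)⟩
  obtain ⟨D, hD, hDT⟩ := key
    (Quotient.mk s '' {R | R ∈ C ∧ P R ∧ n + 3 ≤ size R ∧ size R ≤ n + 4})
    ((hfin (n + 4)).subset (Set.image_mono fun R hR => ⟨hR.1, hR.2.2.2⟩)) (by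
      rintro _ ⟨R, ⟨-, hPR, h1, -⟩, rfl⟩
      have hR : R ∉ ⋂₀ 𝒟 := fun hR => by
        have := hcon R hR hPR
        omega
      simp only [Set.mem_sInter, not_forall] at hR
      obtain ⟨D, hD, hRD⟩ := hR
      refine ⟨D, hD, ?_⟩
      rintro ⟨S, hS, hSR⟩
      exact hRD ((h𝒟 hD).2.1 S hS R (hiso _ _ (s.symm (Quotient.exact hSR)))))
  obtain ⟨R, hR, hPR, h1, h2⟩ := large D (h𝒟 hD).1 (h𝒟 hD).2.1 (h𝒟 hD).2.2 n
  exact hDT _ ⟨R, ⟨(h𝒟 hD).1 hR, hPR, h1, h2⟩, rfl⟩ ⟨R, hR, rfl⟩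

end MinimalClass

open PairColouring

/-! ### Graphs, with adjacency as the colouring. -/

namespace GraphClasses

theorem finite_image_card_le (n : ℕ) :
    (Quotient.mk isoSetoid.{w} '' {G | Finite G.α ∧ Nat.card G.α ≤ n}).Finite := by
  let f : (Σ k : Fin (n + 1), SimpleGraph (ULift.{w} (Fin k))) → Quotient isoSetoid.{w} :=
    fun p => Quotient.mk _ ⟨_, p.2⟩
  refine (Set.finite_range f).subset ?_
  rintro _ ⟨⟨V, G⟩, ⟨hf, hn⟩, rfl⟩
  have e : ULift.{w} (Fin (Nat.card V)) ≃ V :=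
    Equiv.ulift.trans (@Finite.equivFin V hf).symm
  exact ⟨⟨⟨Nat.card V, Nat.lt_succ_of_le hn⟩, G.comap e⟩, Quotient.sound ⟨SimpleGraph.Iso.comap e G⟩⟩

theorem isPrimeOn_univ {V : Type*} {G : SimpleGraph V} (h : IsPrime G) :
    IsPrimeOn G.Adj Set.univ := by
  intro A hA a ha _ b hb _ hab
  rcases h A fun a ha b hb x hx => (hA a ha trivial b hb trivial x trivial hx).to_iff with
    rfl | ⟨x, rfl⟩ | rfl
  · exact absurd ha (by simp)
  · exact absurd (ha.trans hb.symm) hab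
  · exact subset_rfl

theorem isPrime_induce {V : Type*} {G : SimpleGraph V} {S : Set V} (h : IsPrimeOn G.Adj S) :
    IsPrime (G.induce S) := by
  intro A hA
  by_cases hs : A.Subsingleton
  · rcases hs.eq_empty_or_singleton with h | h
    exacts [Or.inl h, Or.inr (Or.inl h)]
  · refine Or.inr (Or.inr ?_)
    obtain ⟨a, ha, b, hb, hab⟩ := Set.not_subsingleton_iff.1 hs
    have := h (Subtype.val '' A) ?_ a ⟨a, ha, rfl⟩ a.2 b ⟨b, hb, rfl⟩ b.2
      (fun h => hab (Subtype.ext h))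
    · refine Set.eq_univ_of_forall fun x => ?_
      obtain ⟨y, hy, hyx⟩ := this x.2
      rwa [← Subtype.ext hyx]
    · rintro _ ⟨p, hp, rfl⟩ _ _ ⟨q, hq, rfl⟩ _ x hx hxA
      exact propext (hA p hp q hq ⟨x, hx⟩ fun h => hxA ⟨_, h, rfl⟩)

theorem exists_isMinimalPrime {C : Set (Bundled.{w} SimpleGraph)} (hC : IsHereditaryClass C)
    (hinf : (primeTypes C).Infinite) : ∃ D ⊆ C, IsMinimalPrime D := by
  obtain ⟨D, hDC, hD, hDinf, hmin⟩ := exists_minimal_lowerClass (s := isoSetoid.{w})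
    (r := fun H G => Nonempty (H.str ↪g G.str)) (size := fun G => Nat.card G.α)
    (P := fun G => IsPrime G.str) (C := C) (fun _ _ ⟨e⟩ => ⟨e.toEmbedding⟩)
    (fun _ _ ⟨e⟩ => Nat.card_congr e.toEquiv)
    (fun n => (finite_image_card_le n).subset (Set.image_mono fun G hG => ⟨hC.1 G hG.1, hG.2⟩))
    (fun n G hG hp hn => by
      have := hC.1 G hG
      obtain ⟨S, -, h1, h2, hS⟩ := (isPrimeOn_univ hp).exists_ncard_le
        (fun a b a' b' h => by rwa [G.str.adj_comm b, G.str.adj_comm b']) (n := n)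
        (by rwa [Set.ncard_univ])
      exact ⟨⟨_, G.str.induce S⟩, ⟨SimpleGraph.Embedding.induce S⟩, h1, h2,
        isPrime_induce hS⟩)
    hC.2 hinf
  exact ⟨D, hDC, ⟨fun G hG => hC.1 G (hDC hG), hD⟩, hDinf, fun E hE hEr => hmin E hE hEr.2⟩

end GraphClasses

/-! ### Binary structures, with `pairType` as the colouring. -/

namespace BinaryStructures

open FirstOrder FirstOrder.Language FirstOrder.Language.Structure

variable {L : FirstOrder.Language.{u, v}}

theorem finite_structure (hL : IsFiniteBinarySignature L) (M : Type*) [Finite M] :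
    Finite (L.Structure M) := by
  have := hL.isRelational
  have := hL.finite_relations
  let f : L.Structure M → ((p : Σ n, L.Relations n) → (Fin p.1 → M) → Prop) :=
    fun S p => S.RelMap p.2
  refine Finite.of_injective f fun S T h => ?_
  refine Structure.ext ?_ ?_
  · funext n g
    exact isEmptyElim g
  · funext n g
    exact congrFun h ⟨n, g⟩

theorem finite_image_card_le (hL : IsFiniteBinarySignature L) (n : ℕ) :
    (Quotient.mk (equivSetoid (L := L)) ''
      {R : Bundled.{w} L.Structure | Finite R ∧ Nat.card R ≤ n}).Finite := by
  have (k : ℕ) := finite_structure hL (ULift.{w} (Fin k))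
  let f : (Σ k : Fin (n + 1), L.Structure (ULift.{w} (Fin k))) →
      Quotient (equivSetoid (L := L)) := fun p => Quotient.mk _ ⟨_, p.2⟩
  refine (Set.finite_range f).subset ?_
  rintro _ ⟨⟨V, R⟩, ⟨hf, hn⟩, rfl⟩
  have e : V ≃ ULift.{w} (Fin (Nat.card V)) :=
    (@Finite.equivFin V hf).trans Equiv.ulift.symm
  refine ⟨⟨⟨Nat.card V, Nat.lt_succ_of_le hn⟩, e.inducedStructure⟩,
    Quotient.sound ?_⟩
  let := e.inducedStructure (L := L)
  exact ⟨(e.inducedStructureEquiv (L := L)).symm⟩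

/-- The isomorphism type of the binary structure on a pair. -/
def pairType (L : FirstOrder.Language.{u, v}) (V : Type*) [L.Structure V] (a b : V) :
    L.Relations 2 → Prop × Prop :=
  fun r => (RelMap r ![a, b], RelMap r ![b, a])

theorem pairType_eq_iff {V : Type*} [L.Structure V] {a b a' b' : V} :
    pairType L V a b = pairType L V a' b' ↔ ∀ r : L.Relations 2,
      (RelMap r ![a, b] ↔ RelMap r ![a', b']) ∧ (RelMap r ![b, a] ↔ RelMap r ![b', a']) := by
  simp [pairType, funext_iff, Prod.ext_iff]

/-- `pairType` records both orders of the pair, so reversal only swaps coordinates. -/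
theorem isReversible_pairType (V : Type*) [L.Structure V] : IsReversible (pairType L V) := by
  intro a b a' b' h
  rw [pairType_eq_iff] at h ⊢
  exact fun r => (h r).symm

theorem isPrimeOn_univ {V : Type*} [L.Structure V] (h : IsPrime L V) :
    IsPrimeOn (pairType L V) Set.univ := by
  intro A hA a ha _ b hb _ hab
  rcases h A fun r a ha b hb x hx =>
    pairType_eq_iff.1 (hA a ha trivial b hb trivial x trivial hx) r with rfl | ⟨x, rfl⟩ | rfl
  · exact absurd ha (by simp)
  · exact absurd (ha.trans hb.symm) hab
  · exact subset_rfl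

theorem isPrime_substructure {V : Type*} [L.Structure V] {S : L.Substructure V}
    (h : IsPrimeOn (pairType L V) (S : Set V)) : IsPrime L S := by
  intro A hA
  by_cases hs : A.Subsingleton
  · rcases hs.eq_empty_or_singleton with h | h
    exacts [Or.inl h, Or.inr (Or.inl h)]
  · refine Or.inr (Or.inr ?_)
    obtain ⟨a, ha, b, hb, hab⟩ := Set.not_subsingleton_iff.1 hs
    have := h (Subtype.val '' A) ?_ a ⟨a, ha, rfl⟩ a.2 b ⟨b, hb, rfl⟩ b.2
      (fun h => hab (Subtype.ext h))
    · refine Set.eq_univ_of_forall fun x => ?_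
      obtain ⟨y, hy, hyx⟩ := this x.2
      rwa [← Subtype.ext hyx]
    · rintro _ ⟨p, hp, rfl⟩ _ _ ⟨q, hq, rfl⟩ _ x hx hxA
      rw [pairType_eq_iff]
      intro r
      have := hA r p hp q hq ⟨x, hx⟩ fun h => hxA ⟨_, h, rfl⟩
      have hvec : ∀ y z : S, ![(y : V), (z : V)] = S.subtype ∘ ![y, z] := fun y z => by
        ext i; fin_cases i <;> rfl
      rw [hvec ⟨x, hx⟩ p, hvec ⟨x, hx⟩ q, hvec p ⟨x, hx⟩, hvec q ⟨x, hx⟩]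
      simpa only [S.subtype.map_rel] using this

theorem exists_isMinimalPrime (hL : IsFiniteBinarySignature L) {C : Set (Bundled.{w} L.Structure)}
    (hC : IsHereditaryClass C) (hinf : (primeTypes C).Infinite) : ∃ D ⊆ C, IsMinimalPrime D := by
  have := hL.isRelational
  -- `Hereditary` is phrased with finitely generated structures; finiteness of the members makes
  -- this plain embeddability.
  have fg (R : Bundled.{w} L.Structure) (h : Finite R) : Structure.FG L R := Structure.FG.of_finite
  obtain ⟨D, hDC, hD, hDinf, hmin⟩ := exists_minimal_lowerClass (s := equivSetoid (L := L))
    (r := fun R S : Bundled.{w} L.Structure => Nonempty (R ↪[L] S)) (size := fun R => Nat.card R)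
    (P := fun R => IsPrime L R) (C := C) (fun _ _ ⟨e⟩ => ⟨e.toEmbedding⟩)
    (fun _ _ ⟨e⟩ => Nat.card_congr e.toEquiv)
    (fun n => (finite_image_card_le hL n).subset
      (Set.image_mono fun G hG => ⟨hC.1 G hG.1, hG.2⟩))
    (fun n R hR hp hn => by
      have := hC.1 R hR
      obtain ⟨S, -, h1, h2, hS⟩ := (isPrimeOn_univ hp).exists_ncard_le (isReversible_pairType R)
        (n := n) (by rwa [Set.ncard_univ])
      -- With no function symbols, every subset is the domain of a substructure.
      let T : L.Substructure R := ⟨S, fun f => isEmptyElim f⟩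
      exact ⟨Bundled.of T, ⟨T.subtype⟩, h1, h2, isPrime_substructure (S := T) hS⟩)
    (fun R hR S ⟨e⟩ => hC.2 R hR ⟨by
      have := hC.1 R hR
      exact fg S (Finite.of_injective e e.injective), ⟨e⟩⟩) hinf
  exact ⟨D, hDC, ⟨fun G hG => hC.1 G (hDC hG), fun R hR S hS => hD R hR S hS.2⟩, hDinf,
    fun E hE hEr => hmin E hE fun R hR S ⟨e⟩ => hEr.2 R hR ⟨by
      have := hEr.1 R hR
      exact fg S (Finite.of_injective e e.injective), ⟨e⟩⟩⟩

end BinaryStructures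

theorem mainTheorem3 :
    (∀ C : Set (Bundled.{w} SimpleGraph),
      GraphClasses.IsHereditaryClass C → (GraphClasses.primeTypes C).Infinite →
        ∃ D : Set (Bundled.{w} SimpleGraph), D ⊆ C ∧ GraphClasses.IsMinimalPrime D) ∧
    (∀ L : FirstOrder.Language.{u, v}, BinaryStructures.IsFiniteBinarySignature L →
      ∀ C : Set (Bundled.{w} L.Structure),
        BinaryStructures.IsHereditaryClass C → (BinaryStructures.primeTypes C).Infinite →
          ∃ D : Set (Bundled.{w} L.Structure), D ⊆ C ∧ BinaryStructures.IsMinimalPrime D) := by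
  exact ⟨fun _ hC h => GraphClasses.exists_isMinimalPrime hC h,
    fun _ hL _ hC h => BinaryStructures.exists_isMinimalPrime hL hC h⟩
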